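/- A kernel is a (Lebesgue measurable) function $f:[0,1]^2\to[0,1]$ with $f(x,y)=f(y,x)$. A stochastic block model kernel is a kernel $f_{\mathrm{SBM}}$ for which there are $c\in\mathbb N$, $\boldsymbol p\in[0,1]^c$, $q\in[0,1]$ and $\boldsymbol s\in[0,1]^c$ with $\sum_{k=1}^c s_k=1$ such that $f_{\mathrm{SBM}}(x,y)=p_k$ if $x$ and $y$ both lie in the block $\big[\sum_{j=1}^{k-1}s_j,\ \sum_{j=1}^{k}s_j\big)$, and $f_{\mathrm{SBM}}(x,y)=q$ if $x$ and $y$ do not lie in a common block. For a kernel $f$ let $L_f$ be the self-adjoint operator $(L_fg)(x)=\int_0^1 f(x,y)g(y)\,dy$ on $L^2([0,1])$. Let $\sigma(L_f)$ be its spectrum, listed in descending order with multiplicities and padded with zeros, $$\lambda_0\ge\lambda_1\ge\lambda_2\ge\cdots\ \ge 0\ge\ \cdots\ge\lambda_{-3}\ge\lambda_{-2}\ge\lambda_{-1},$$ where $\lambda_0,\lambda_1,\dots$ are the positive eigenvalues in decreasing order, followed by zeros if there are only finitely many, and $\lambda_{-1},\lambda_{-2},\dots$ are the negative eigenvalues in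 increasing order, likewise followed by zeros. **Theorem.** Let $f$ be a kernel and $f_{\mathrm{SBM}}$ a stochastic block model kernel. Then the sorted spectra $\sigma(L_f)$ and $\sigma(L_{f_{\mathrm{SBM}}})$ exist, are uniquely determined, and are square summable, with $\|\sigma(L_f)\|_{\ell^2}=\|f\|_{L^2([0,1]^2)}$ and $\|\sigma(L_{f_{\mathrm{SBM}}})\|_{\ell^2}=\|f_{\mathrm{SBM}}\|_{L^2([0,1]^2)}$. Moreover, for every $\varepsilon>0$, $$\|f-f_{\mathrm{SBM}}\|_{L^2([0,1]^2)}<\varepsilon\quad\Longrightarrow\quad\|\sigma(L_f)-\sigma(L_{f_{\mathrm{SBM}}})\|_{\ell^2}<\tfrac{25}{4}\,\varepsilon .$$ -/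

import Mathlib

open MeasureTheory

/-- A (symmetric, measurable) kernel `f : [0,1] × [0,1] → [0,1]`. -/
structure GraphKernel where
  /-- the underlying function on the unit square -/
  toFun : unitInterval → unitInterval → ℝ
  aemeasurable' : AEMeasurable (Function.uncurry toFun) volume
  symm' : ∀ x y, toFun x y = toFun y x
  mem_Icc' : ∀ x y, toFun x y ∈ Set.Icc (0 : ℝ) 1

instance : CoeFun GraphKernel (fun _ => unitInterval → unitInterval → ℝ) := ⟨GraphKernel.toFun⟩

/-- The `k`-th block `[s₀ + ⋯ + s_{k-1}, s₀ + ⋯ + s_k)` of the geometry `s`. -/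
def sbmBlock {c : ℕ} (s : Fin c → ℝ) (k : Fin c) : Set unitInterval :=
  {x | ∑ j ∈ Finset.Iio k, s j ≤ (x : ℝ) ∧ (x : ℝ) < ∑ j ∈ Finset.Iic k, s j}

/-- The set of canonical kernels of stochastic block models: `f x y = p k` if `x` and `y` both lie
in the block `k`, and `f x y = q` if they do not lie in a common block. -/
def sbmKernels : Set GraphKernel :=
  {f | ∃ (c : ℕ) (p : Fin c → ℝ) (q : ℝ) (s : Fin c → ℝ),
    (∀ k, p k ∈ Set.Icc (0 : ℝ) 1) ∧ q ∈ Set.Icc (0 : ℝ) 1 ∧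
    (∀ k, s k ∈ Set.Icc (0 : ℝ) 1) ∧ ∑ k, s k = 1 ∧
    ∀ x y, (∀ k, x ∈ sbmBlock s k → y ∈ sbmBlock s k → f x y = p k) ∧
      ((¬ ∃ k, x ∈ sbmBlock s k ∧ y ∈ sbmBlock s k) → f x y = q)}

/-- The real Hilbert space `L²([0,1])`. -/
abbrev L2Unit : Type := Lp ℝ 2 (volume : Measure unitInterval)

namespace GraphKernel

/-- The function `x ↦ ∫₀¹ f(x,y) g(y) dy`. -/
noncomputable def integralFun (f : GraphKernel) (g : unitInterval → ℝ) (x : unitInterval) : ℝ :=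
  ∫ y, f x y * g y

theorem norm_mul_le (f : GraphKernel) (g : unitInterval → ℝ) (x y : unitInterval) :
    ‖f x y * g y‖ ≤ ‖g y‖ := by
  obtain ⟨h0, h1⟩ := f.mem_Icc' x y
  rw [norm_mul, Real.norm_of_nonneg h0]
  exact mul_le_of_le_one_left (norm_nonneg _) h1

theorem integrable_L2 (g : L2Unit) : Integrable g volume :=
  (Lp.memLp g).integrable (by norm_num)

theorem ae_integrable_mul (f : GraphKernel) (g : L2Unit) :
    ∀ᵐ x : unitInterval, Integrable (fun y => f x y * g y) volume := by
  have h : AEStronglyMeasurable (Function.uncurry f.toFun)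
      ((volume : Measure unitInterval).prod volume) := f.aemeasurable'.aestronglyMeasurable
  filter_upwards [h.prodMk_left] with x hx
  exact (integrable_L2 g).mono (hx.mul (Lp.aestronglyMeasurable g))
    (Filter.Eventually.of_forall fun y => f.norm_mul_le g x y)

theorem norm_integralFun_le (f : GraphKernel) (g : L2Unit) (x : unitInterval) :
    ‖f.integralFun g x‖ ≤ ∫ y, ‖g y‖ :=
  norm_integral_le_of_norm_le (integrable_L2 g).norm
    (Filter.Eventually.of_forall fun y => f.norm_mul_le g x y)

theorem memLp_integralFun (f : GraphKernel) (g : L2Unit) :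
    MemLp (f.integralFun g) 2 volume := by
  have h : AEStronglyMeasurable (Function.uncurry f.toFun)
      ((volume : Measure unitInterval).prod volume) := f.aemeasurable'.aestronglyMeasurable
  have h2 : AEStronglyMeasurable (fun z : unitInterval × unitInterval => f z.1 z.2 * g z.2)
      ((volume : Measure unitInterval).prod volume) :=
    h.mul (Lp.aestronglyMeasurable g).comp_snd
  exact MemLp.of_bound h2.integral_prod_right' _
    (Filter.Eventually.of_forall (f.norm_integralFun_le g))

/-- The linear integral operator `L_f` on `L²([0,1])`, `(L_f g)(x) = ∫₀¹ f(x,y) g(y) dy`. -/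
noncomputable def integralOperator (f : GraphKernel) : L2Unit →ₗ[ℝ] L2Unit where
  toFun g := (f.memLp_integralFun g).toLp (f.integralFun g)
  map_add' g h := by
    rw [← MemLp.toLp_add, MemLp.toLp_eq_toLp_iff]
    filter_upwards [f.ae_integrable_mul g, f.ae_integrable_mul h] with x hg hh
    simp only [Pi.add_apply, integralFun]
    rw [← integral_add hg hh]
    refine integral_congr_ae ?_
    filter_upwards [Lp.coeFn_add g h] with y hy
    simp only [hy, Pi.add_apply, mul_add]
  map_smul' r g := by
    rw [RingHom.id_apply, ← MemLp.toLp_const_smul, MemLp.toLp_eq_toLp_iff]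
    refine Filter.Eventually.of_forall fun x => ?_
    simp only [Pi.smul_apply, integralFun, smul_eq_mul]
    rw [← integral_const_mul]
    refine integral_congr_ae ?_
    filter_upwards [Lp.coeFn_smul r g] with y hy
    simp only [hy, Pi.smul_apply, smul_eq_mul]
    ring

end GraphKernel

/-- `a` lists the spectrum of `T` in descending order, with multiplicities. The index set
`ℕ ⊕ₗ ℕᵒᵈ` (a copy of `ℕ` followed by a reversed copy of `ℕ`) has the order type of a list
`a₀ ≥ a₁ ≥ a₂ ≥ ⋯ ≥ 0 ≥ ⋯ ≥ b₂ ≥ b₁ ≥ b₀`: the first copy carries the positive eigenvalues and the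
second the negative ones, each padded with zeros when there are only finitely many. Every nonzero
real number occurs as often as its multiplicity as an eigenvalue of `T` says. -/
structure IsDescendingSpectrum {E : Type*} [AddCommGroup E] [Module ℝ E] (T : E →ₗ[ℝ] E)
    (a : ℕ ⊕ₗ ℕᵒᵈ → ℝ) : Prop where
  antitone : Antitone a
  nonneg : ∀ i : ℕ, 0 ≤ a (Sum.inlₗ i)
  nonpos : ∀ i : ℕᵒᵈ, a (Sum.inrₗ i) ≤ 0
  encard_eq : ∀ μ : ℝ, μ ≠ 0 →
    {i | a i = μ}.encard = Cardinal.toENat (Module.rank ℝ (Module.End.eigenspace T μ))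

open scoped InnerProductSpace

/-! The closeness statement is the Hoffman–Wielandt inequality for Hilbert–Schmidt operators, which
holds with constant 1. By Parseval on almost every slice, the squared Hilbert–Schmidt norm of an
integral operator is the squared `L²` norm of its kernel, in every Hilbert basis
(`hasSum_norm_sq_of_integral_kernel`). Evaluated in a basis extending the eigenvectors, it is the
sum of the squared eigenvalues.

For symmetric `A` and `B`, polarisation turns the claim into `tr(AB) ≤ ∑ a i * b i`
(`IsDescendingSpectrum.tsum_sub_sq_le`). With eigenvectors `u i` of `A` and `v j` of `B`, the trace
is the sum of `a i * b j * ⟪v j, u i⟫ ^ 2`, and by Bessel the matrix of squared inner products is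
doubly substochastic. Pairs of eigenvalues of opposite sign contribute at most zero and can be
dropped. The positive and the negative parts are then treated separately by the rearrangement bound
`tsum_mul_le_tsum_mul`.

Existence of the sorted spectrum combines compactness, the spectral theorem and
`exists_antitone_rearrangement`; uniqueness is `eq_of_antitone_of_encard_eq`. -/

/-! ### Rearrangement inequalities for doubly substochastic matrices -/

/-- A finite form of the von Neumann trace inequality: pairing two decreasing nonnegative sequences
through a doubly substochastic matrix does not exceed pairing them termwise. -/
theorem sum_sum_mul_le_sum_mul {D : ℕ → ℕ → ℝ}
    (hrow : ∀ N i, ∑ j ∈ Finset.range N, D i j ≤ 1)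
    (hcol : ∀ N j, ∑ i ∈ Finset.range N, D i j ≤ 1) (N : ℕ) :
    ∀ {α β : ℕ → ℝ}, (∀ i j, i ≤ j → j < N → α j ≤ α i) → (∀ i j, i ≤ j → j < N → β j ≤ β i) →
      (∀ i < N, 0 ≤ α i) → (∀ i < N, 0 ≤ β i) →
      ∑ i ∈ Finset.range N, ∑ j ∈ Finset.range N, α i * β j * D i j
        ≤ ∑ i ∈ Finset.range N, α i * β i := by
  induction N with
  | zero => simp
  | succ N ih =>
    intro α β hα hβ hα0 hβ0
    -- Subtracting the last entries keeps both sequences decreasing and nonnegative and makes their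
    -- last terms vanish, so the size drops by one. The correction terms have nonnegative weights,
    -- so row and column sums at most 1 suffice.
    have h1 := @ih (fun i => α i - α N) (fun i => β i - β N)
      (fun i j hij hj => by have := hα i j hij (by omega); linarith)
      (fun i j hij hj => by have := hβ i j hij (by omega); linarith)
      (fun i hi => by have := hα i N (by omega) (by omega); linarith)
      (fun i hi => by have := hβ i N (by omega) (by omega); linarith)
    have ha := hα0 N (by omega)
    have hb := hβ0 N (by omega)
    have e1 : ∑ i ∈ Finset.range (N + 1), ∑ j ∈ Finset.range (N + 1), α i * β j * D i j
        = ∑ i ∈ Finset.range (N + 1), ∑ j ∈ Finset.range (N + 1), (α i - α N) * (β j - β N) * D i j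
          + β N * ∑ i ∈ Finset.range (N + 1), (α i - α N) * ∑ j ∈ Finset.range (N + 1), D i j
          + α N * ∑ j ∈ Finset.range (N + 1), (β j - β N) * ∑ i ∈ Finset.range (N + 1), D i j
          + α N * β N * ∑ i ∈ Finset.range (N + 1), ∑ j ∈ Finset.range (N + 1), D i j := by
      have e : ∑ j ∈ Finset.range (N + 1), (β j - β N) * ∑ i ∈ Finset.range (N + 1), D i j
          = ∑ i ∈ Finset.range (N + 1), ∑ j ∈ Finset.range (N + 1), (β j - β N) * D i j := by
        rw [Finset.sum_comm]
        simp only [Finset.mul_sum]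
      rw [e]
      simp only [Finset.mul_sum, ← Finset.sum_add_distrib]
      exact Finset.sum_congr rfl fun i _ => Finset.sum_congr rfl fun j _ => by ring
    have e2 : ∑ i ∈ Finset.range (N + 1), ∑ j ∈ Finset.range (N + 1),
        (α i - α N) * (β j - β N) * D i j
        = ∑ i ∈ Finset.range N, ∑ j ∈ Finset.range N, (α i - α N) * (β j - β N) * D i j := by
      simp [Finset.sum_range_succ]
    have i1 : ∑ i ∈ Finset.range (N + 1), (α i - α N) * ∑ j ∈ Finset.range (N + 1), D i j
        ≤ ∑ i ∈ Finset.range (N + 1), (α i - α N) := by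
      refine Finset.sum_le_sum fun i hi => mul_le_of_le_one_right ?_ (hrow _ _)
      have := hα i N (by simp at hi; omega) (by omega)
      linarith
    have i2 : ∑ j ∈ Finset.range (N + 1), (β j - β N) * ∑ i ∈ Finset.range (N + 1), D i j
        ≤ ∑ j ∈ Finset.range (N + 1), (β j - β N) := by
      refine Finset.sum_le_sum fun i hi => mul_le_of_le_one_right ?_ (hcol _ _)
      have := hβ i N (by simp at hi; omega) (by omega)
      linarith
    have i3 : ∑ i ∈ Finset.range (N + 1), ∑ j ∈ Finset.range (N + 1), D i j
        ≤ ∑ _i ∈ Finset.range (N + 1), (1 : ℝ) := Finset.sum_le_sum fun i _ => hrow _ _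
    have e3 : ∑ i ∈ Finset.range (N + 1), α i * β i
        = ∑ i ∈ Finset.range N, (α i - α N) * (β i - β N)
          + β N * ∑ i ∈ Finset.range (N + 1), (α i - α N)
          + α N * ∑ i ∈ Finset.range (N + 1), (β i - β N)
          + α N * β N * ∑ _i ∈ Finset.range (N + 1), (1 : ℝ) := by
      have : ∑ i ∈ Finset.range N, (α i - α N) * (β i - β N)
          = ∑ i ∈ Finset.range (N + 1), (α i - α N) * (β i - β N) := by
        simp [Finset.sum_range_succ]
      rw [this]
      simp only [Finset.mul_sum, ← Finset.sum_add_distrib]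
      exact Finset.sum_congr rfl fun i _ => by ring
    rw [e1, e2, e3]
    have := mul_le_mul_of_nonneg_left i1 hb
    have := mul_le_mul_of_nonneg_left i2 ha
    have := mul_le_mul_of_nonneg_left i3 (mul_nonneg ha hb)
    linarith

/-- The limit form of `sum_sum_mul_le_sum_mul`. -/
theorem tsum_mul_le_tsum_mul {D : ℕ → ℕ → ℝ} {α β γ : ℕ → ℝ} (hD : ∀ i j, 0 ≤ D i j)
    (hrow : ∀ N i, ∑ j ∈ Finset.range N, D i j ≤ 1)
    (hcol : ∀ N j, ∑ i ∈ Finset.range N, D i j ≤ 1)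
    (hα : Antitone α) (hβ : Antitone β) (hα0 : ∀ i, 0 ≤ α i) (hβ0 : ∀ i, 0 ≤ β i)
    (hγ : ∀ i, α i ≠ 0 → ∃ δ, γ i ≤ δ ∧ HasSum (fun j => β j * D i j) δ)
    (hαγ : Summable fun i => α i * γ i) (hαβ : Summable fun i => α i * β i) :
    ∑' i, α i * γ i ≤ ∑' i, α i * β i := by
  refine le_of_tendsto' hαγ.hasSum.tendsto_sum_nat fun N => ?_
  have h : ∀ i, ∃ δ, α i * γ i ≤ δ ∧ HasSum (fun j => α i * β j * D i j) δ := by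
    intro i
    by_cases hi : α i = 0
    · exact ⟨0, by simp [hi], by simp [hi]⟩
    · obtain ⟨δ, h1, h2⟩ := hγ i hi
      refine ⟨α i * δ, mul_le_mul_of_nonneg_left h1 (hα0 i), ?_⟩
      simpa only [mul_assoc] using h2.mul_left (α i)
  choose δ h1 h2 using h
  refine (Finset.sum_le_sum fun i _ => h1 i).trans ?_
  -- The rows stay truncated at `N` while the column cutoff `M` tends to infinity; for `M ≥ N`,
  -- nonnegativity allows enlarging to an `M × M` square.
  refine le_of_tendsto (tendsto_finsetSum _ fun i _ => (h2 i).tendsto_sum_nat) ?_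
  filter_upwards [Filter.eventually_ge_atTop N] with M hM
  calc ∑ i ∈ Finset.range N, ∑ j ∈ Finset.range M, α i * β j * D i j
      ≤ ∑ i ∈ Finset.range M, ∑ j ∈ Finset.range M, α i * β j * D i j := by
        refine Finset.sum_le_sum_of_subset_of_nonneg (by simpa using hM) fun i _ _ => ?_
        exact Finset.sum_nonneg fun j _ => mul_nonneg (mul_nonneg (hα0 i) (hβ0 j)) (hD i j)
    _ ≤ ∑ i ∈ Finset.range M, α i * β i :=
        sum_sum_mul_le_sum_mul hrow hcol M (fun i j hij _ => hα hij) (fun i j hij _ => hβ hij)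
          (fun i _ => hα0 i) (fun i _ => hβ0 i)
    _ ≤ ∑' i, α i * β i :=
        hαβ.sum_le_tsum _ fun i _ => mul_nonneg (hα0 i) (hβ0 i)

/-! ### Decreasing rearrangements -/

/-- A decreasing nonnegative sequence is determined by the multiplicities of its positive values. -/
theorem eq_of_antitone_of_encard_eq {α β : ℕ → ℝ} (hα : Antitone α) (hβ : Antitone β)
    (hα0 : ∀ i, 0 ≤ α i) (hβ0 : ∀ i, 0 ≤ β i)
    (h : ∀ μ, 0 < μ → {i | α i = μ}.encard = {i | β i = μ}.encard) : α = β := by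
  -- At a first index with `β n < α n`, the value `α n` occurs in `β` only before `n`, where the
  -- sequences agree; `α` takes it once more, at `n`, contradicting equal multiplicities.
  have key : ∀ {α β : ℕ → ℝ}, Antitone β → (∀ i, 0 ≤ β i) →
      (∀ μ, 0 < μ → {i | α i = μ}.encard = {i | β i = μ}.encard) →
      ∀ n, (∀ k < n, α k = β k) → α n ≤ β n := by
    intro α β hβ hβ0 h n hn
    by_contra! hlt
    have hpos : 0 < α n := (hβ0 n).trans_lt hlt
    have hsub : {i | β i = α n} ⊆ Set.Iio n := by
      intro i hi
      by_contra! hni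
      have := hβ (not_lt.mp hni : n ≤ i)
      rw [Set.mem_ofPred_eq] at hi
      linarith
    have hss : {i | β i = α n} ⊂ {i | α i = α n} := by
      refine ⟨fun i hi => ?_, fun hs => ?_⟩
      · rw [Set.mem_ofPred_eq] at hi ⊢
        rw [hn i (hsub hi), hi]
      · have : β n = α n := hs (show α n = α n from rfl)
        linarith
    have := ((Set.finite_Iio n).subset hsub).encard_lt_encard hss
    rw [h _ hpos] at this
    exact lt_irrefl _ this
  funext n
  induction n using Nat.strong_induction_on with
  | _ n ih =>
    exact le_antisymm (key hβ hβ0 h n ih)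
      (key hα hα0 (fun μ hμ => (h μ hμ).symm) n fun k hk => (ih k hk).symm)

/-- A family of reals with finitely many members above each positive level has a decreasing
rearrangement of its positive members, padded with zeros. -/
theorem exists_antitone_rearrangement {J : Type*} (κ : J → ℝ)
    (hfin : ∀ t, 0 < t → {j | t < κ j}.Finite) :
    ∃ α : ℕ → ℝ, Antitone α ∧ (∀ i, 0 ≤ α i) ∧
      ∀ μ, 0 < μ → {i | α i = μ}.encard = {j | κ j = μ}.encard := by
  -- The rearrangement is the generalised inverse of the counting function `N`: its `n`-th term is
  -- the infimum of the positive levels exceeded by at most `n` members.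
  set N : ℝ → ℕ := fun t => {j | t < κ j}.ncard with hN
  set S : ℕ → Set ℝ := fun n => {t | 0 < t ∧ N t ≤ n} with hS
  have hbdd : ∀ n, BddBelow (S n) := fun n => ⟨0, fun t ht => ht.1.le⟩
  have hne : ∀ n, (S n).Nonempty := by
    intro n
    obtain ⟨M, hM⟩ := ((hfin 1 one_pos).image κ).bddAbove
    refine ⟨max M 1, by positivity, ?_⟩
    have : {j | max M 1 < κ j} = ∅ := by
      ext j
      simp only [Set.mem_ofPred_eq, Set.mem_empty_iff_false, iff_false, not_lt]
      by_contra! hj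
      have h1 : κ j ≤ M := hM ⟨j, (le_max_right M 1).trans_lt hj, rfl⟩
      exact absurd h1 (not_le.mpr ((le_max_left M 1).trans_lt hj))
    rw [hN]
    simp only [this, Set.ncard_empty, zero_le]
  have hnn : ∀ n, 0 ≤ sInf (S n) := fun n => Real.sInf_nonneg fun t ht => ht.1.le
  -- the next level above `t` that is attained
  have hgap : ∀ t, 0 < t → ∃ s, t < s ∧ ∀ r, r < s → {j | t < κ j} ⊆ {j | r < κ j} := by
    intro t ht
    rcases {j | t < κ j}.eq_empty_or_nonempty with h | h
    · exact ⟨t + 1, by linarith, fun r _ => by simp [h]⟩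
    · obtain ⟨j0, hj0, hmin⟩ := Set.exists_min_image _ κ (hfin t ht) h
      exact ⟨κ j0, hj0, fun r hr j hj => hr.trans_le (hmin j hj)⟩
  have hlt : ∀ t, 0 < t → ∀ n, t < sInf (S n) ↔ n < N t := by
    intro t ht n
    constructor
    · intro h
      by_contra! hn
      exact absurd (csInf_le (hbdd n) (show t ∈ S n from ⟨ht, hn⟩)) (not_le.mpr h)
    · intro h
      obtain ⟨s, hts, hs⟩ := hgap t ht
      refine hts.trans_le (le_csInf (hne n) fun r hr => ?_)
      by_contra! hrs
      have := Set.ncard_le_ncard (hs r hrs) (hfin r hr.1)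
      exact absurd hr.2 (not_le.mpr (h.trans_le this))
  refine ⟨fun n => sInf (S n), ?_, hnn, ?_⟩
  · intro m n hmn
    exact csInf_le_csInf (hbdd n) (hne m) fun t ht => ⟨ht.1, ht.2.trans hmn⟩
  · intro μ hμ
    -- With no member strictly between `s` and `μ`, the value `μ` is taken exactly on the indices
    -- from `N μ` up to, but excluding, `N s`.
    obtain ⟨s, hs0, hsμ, hs⟩ : ∃ s, 0 < s ∧ s < μ ∧ ∀ j, s < κ j → μ ≤ κ j := by
      have hf : {j | μ / 2 < κ j ∧ κ j < μ}.Finite :=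
        (hfin (μ / 2) (by positivity)).subset fun j hj => hj.1
      rcases {j | μ / 2 < κ j ∧ κ j < μ}.eq_empty_or_nonempty with h | h
      · refine ⟨μ / 2, by positivity, by linarith, fun j hj => ?_⟩
        by_contra! hj2
        have : j ∈ {j | μ / 2 < κ j ∧ κ j < μ} := ⟨hj, hj2⟩
        simp [h] at this
      · obtain ⟨j0, hj0, hmax⟩ := Set.exists_max_image _ κ hf h
        have hpos : 0 < κ j0 := lt_trans (by positivity) hj0.1
        refine ⟨κ j0, hpos, hj0.2, fun j hj => ?_⟩
        by_contra! hj2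
        exact absurd (hmax j ⟨hj0.1.trans hj, hj2⟩) (not_le.mpr hj)
    have hα : {n | sInf (S n) = μ} = Set.Ico (N μ) (N s) := by
      ext n
      simp only [Set.mem_ofPred_eq, Set.mem_Ico]
      rw [← hlt s hs0, ← not_lt, ← hlt μ hμ, not_lt]
      constructor
      · rintro h
        rw [h]
        exact ⟨le_rfl, hsμ⟩
      · rintro ⟨h1, h2⟩
        refine le_antisymm h1 ?_
        refine le_csInf (hne n) fun r hr => ?_
        by_contra! hrμ
        have : {j | s < κ j} ⊆ {j | r < κ j} := fun j hj => hrμ.trans_le (hs j hj)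
        have := Set.ncard_le_ncard this (hfin r hr.1)
        exact absurd hr.2 (not_le.mpr (((hlt s hs0 n).mp h2).trans_le this))
    have hκ : {j | κ j = μ} = {j | s < κ j} \ {j | μ < κ j} := by
      ext j
      simp only [Set.mem_ofPred_eq, Set.mem_sdiff, not_lt]
      exact ⟨fun h => by simp [h, hsμ], fun h => le_antisymm h.2 (hs j h.1)⟩
    have hsub : {j | μ < κ j} ⊆ {j | s < κ j} := fun j hj => hsμ.trans hj
    rw [hα, hκ, ← Finset.coe_Ico, Set.encard_coe_eq_coe_finsetCard,
      ← ((hfin s hs0).sdiff).cast_ncard_eq, Set.ncard_sdiff hsub (hfin μ hμ)]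
    simp [hN]

/-! ### Compactness from square summability -/

/-- A bounded operator with square summable values on a Hilbert basis is compact. -/
theorem isCompactOperator_of_summable_norm_sq {H ι : Type*} [NormedAddCommGroup H]
    [InnerProductSpace ℝ H] [CompleteSpace H] {T : H →L[ℝ] H} (b : HilbertBasis ι ℝ H)
    (h : Summable fun i => ‖T (b i)‖ ^ 2) : IsCompactOperator T := by
  set F : Finset ι → H →L[ℝ] H := fun s => ∑ i ∈ s, (innerSL ℝ (b i)).smulRight (T (b i)) with hF
  have hFx : ∀ s x, F s x = ∑ i ∈ s, ⟪b i, x⟫_ℝ • T (b i) := fun s x => by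
    simp [hF]
  set S := ∑' i, ‖T (b i)‖ ^ 2 with hS
  have hlim : ∀ x, Filter.Tendsto (fun s => F s x) Filter.atTop (nhds (T x)) := fun x => by
    have h1 : HasSum (fun i => T (b.repr x i • b i)) (T x) := (b.hasSum_repr x).mapL T
    refine h1.congr fun s => ?_
    rw [hFx]
    refine Finset.sum_congr rfl fun i _ => ?_
    exact (T.map_smul _ _).trans (by rw [b.repr_apply_apply])
  -- Cauchy–Schwarz and Bessel bound the error of the finite-rank truncation `F s` by the tail of
  -- the series, giving convergence in operator norm.
  have hbound : ∀ s, ‖T - F s‖ ≤ √(S - ∑ i ∈ s, ‖T (b i)‖ ^ 2) := by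
    intro s
    refine ContinuousLinearMap.opNorm_le_bound _ (Real.sqrt_nonneg _) fun x => ?_
    rw [sub_apply]
    refine le_of_tendsto ((hlim x).sub_const (F s x)).norm ?_
    filter_upwards [Filter.eventually_ge_atTop s] with t hst
    classical
    have hst' : s ⊆ t := hst
    rw [hFx, hFx, ← Finset.sum_sdiff hst', add_sub_cancel_right]
    have h1 : ∑ i ∈ t \ s, ‖T (b i)‖ ^ 2 ≤ S - ∑ i ∈ s, ‖T (b i)‖ ^ 2 := by
      have := h.sum_le_tsum t fun i _ => by positivity
      rw [← Finset.sum_sdiff hst'] at this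
      linarith
    have h2 : ∑ i ∈ t \ s, ‖⟪b i, x⟫_ℝ‖ ^ 2 ≤ ‖x‖ ^ 2 :=
      b.orthonormal.sum_inner_products_le x
    calc ‖∑ i ∈ t \ s, ⟪b i, x⟫_ℝ • T (b i)‖
        ≤ ∑ i ∈ t \ s, ‖⟪b i, x⟫_ℝ‖ * ‖T (b i)‖ := by
          refine (norm_sum_le _ _).trans_eq (Finset.sum_congr rfl fun i _ => norm_smul _ _)
      _ ≤ √(∑ i ∈ t \ s, ‖⟪b i, x⟫_ℝ‖ ^ 2) * √(∑ i ∈ t \ s, ‖T (b i)‖ ^ 2) :=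
          Real.sum_mul_le_sqrt_mul_sqrt _ _ _
      _ ≤ √(‖x‖ ^ 2) * √(S - ∑ i ∈ s, ‖T (b i)‖ ^ 2) := by gcongr
      _ = √(S - ∑ i ∈ s, ‖T (b i)‖ ^ 2) * ‖x‖ := by
          rw [Real.sqrt_sq (norm_nonneg x), mul_comm]
  have htend : Filter.Tendsto F Filter.atTop (nhds T) := by
    rw [tendsto_iff_norm_sub_tendsto_zero]
    have h0 : Filter.Tendsto (fun s : Finset ι => √(S - ∑ i ∈ s, ‖T (b i)‖ ^ 2)) Filter.atTop
        (nhds 0) := by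
      have h1 : Filter.Tendsto (fun s : Finset ι => S - ∑ i ∈ s, ‖T (b i)‖ ^ 2) Filter.atTop
          (nhds (S - S)) := tendsto_const_nhds.sub h.hasSum
      rw [sub_self] at h1
      exact Real.sqrt_zero ▸ (Real.continuous_sqrt.tendsto 0).comp h1
    refine squeeze_zero (fun _ => norm_nonneg _) (fun s => ?_) h0
    rw [norm_sub_rev]
    exact hbound s
  refine isCompactOperator_of_tendsto htend (Filter.Eventually.of_forall fun s => ?_)
  refine Submodule.sum_mem (compactOperator (RingHom.id ℝ) H H) fun i _ => ?_
  exact (isCompactOperator_of_locallyCompactSpace_rng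
    (ContinuousLinearMap.toSpanSingleton ℝ (T (b i)))).comp_clm (innerSL ℝ (b i))

/-! ### Eigenvectors, existence and uniqueness of the descending spectrum -/

section Spectrum

variable {H : Type*} [NormedAddCommGroup H] [InnerProductSpace ℝ H] [CompleteSpace H]

open Module.End

/-- An orthonormal family extends to a Hilbert basis, over which a function that vanishes
orthogonally to the family has the same sums as over the family. -/
theorem Orthonormal.exists_hilbertBasis_hasSum_iff {J : Type*} {w : J → H} (hw : Orthonormal ℝ w) :
    ∃ (s : Set H) (b : HilbertBasis s ℝ H), ∀ G : H → ℝ,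
      (∀ x, (∀ j, ⟪w j, x⟫_ℝ = 0) → G x = 0) →
      ∀ τ, HasSum (fun i => G (b i)) τ ↔ HasSum (fun j => G (w j)) τ := by
  obtain ⟨s, b, hs, hb⟩ := hw.toSubtypeRange.exists_hilbertBasis_extension
  refine ⟨s, b, fun G hG τ => ?_⟩
  set φ : J → s := fun j => ⟨w j, hs ⟨j, rfl⟩⟩ with hφ
  have hbφ : ∀ j, b (φ j) = w j := fun j => by rw [hb]
  have hinj : Function.Injective φ := fun i j hij =>
    hw.linearIndependent.injective (Subtype.ext_iff.mp hij)
  rw [← hinj.hasSum_iff]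
  · simp only [Function.comp_def, hbφ]
  · intro i hi
    refine hG _ fun j => ?_
    rw [← hbφ]
    exact b.orthonormal.2 fun h => hi ⟨j, h⟩

/-- A compact symmetric operator has an orthonormal family of eigenvectors, with nonzero
eigenvalues listed with multiplicities, such that it vanishes orthogonally to the family. -/
theorem exists_orthonormal_eigenvectors {T : H →L[ℝ] H} (hc : IsCompactOperator T)
    (hs : (T : H →ₗ[ℝ] H).IsSymmetric) :
    ∃ (J : Type) (κ : J → ℝ) (w : J → H), Orthonormal ℝ w ∧ (∀ j, κ j ≠ 0) ∧
      (∀ j, T (w j) = κ j • w j) ∧ (∀ x, (∀ j, ⟪w j, x⟫_ℝ = 0) → T x = 0) ∧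
      ∀ μ : ℝ, μ ≠ 0 → {j | κ j = μ}.Finite ∧ {j | κ j = μ}.encard =
        Cardinal.toENat (Module.rank ℝ (eigenspace (T : H →ₗ[ℝ] H) μ)) := by
  have hfd : ∀ μ : {μ : ℝ // μ ≠ 0}, FiniteDimensional ℝ (eigenspace (T : H →ₗ[ℝ] H) μ) :=
    fun μ => ContinuousLinearMap.finite_dimensional_eigenspace hc _ μ.2
  let v : ∀ μ : {μ : ℝ // μ ≠ 0}, OrthonormalBasis
      (Fin (Module.finrank ℝ (eigenspace (T : H →ₗ[ℝ] H) μ))) ℝ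
      (eigenspace (T : H →ₗ[ℝ] H) μ) := fun μ => stdOrthonormalBasis ℝ _
  have horth : OrthogonalFamily ℝ (fun μ : {μ : ℝ // μ ≠ 0} => eigenspace (T : H →ₗ[ℝ] H) μ)
      fun μ => (eigenspace (T : H →ₗ[ℝ] H) μ).subtypeₗᵢ :=
    hs.orthogonalFamily_eigenspaces.comp Subtype.val_injective
  have hev : ∀ (μ : ℝ) (x : eigenspace (T : H →ₗ[ℝ] H) μ), T x = μ • (x : H) := fun μ x =>
    mem_eigenspace_iff.mp x.2
  refine ⟨Σ μ : {μ : ℝ // μ ≠ 0}, Fin (Module.finrank ℝ (eigenspace (T : H →ₗ[ℝ] H) μ)),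
    fun j => j.1, fun j => v j.1 j.2,
    horth.orthonormal_sigma_orthonormal fun μ => (v μ).orthonormal, fun j => j.1.2,
    fun j => hev _ _, ?_, ?_⟩
  · intro x hx
    -- By the spectral theorem it suffices that `T x` is orthogonal to every eigenspace: for
    -- eigenvalue 0 by symmetry of `T`, otherwise because `x` itself is.
    have hbot := ContinuousLinearMap.orthogonalComplement_iSup_eigenspaces_eq_bot hc hs
    rw [← Submodule.mem_bot ℝ, ← hbot, ← Submodule.iInf_orthogonal, Submodule.mem_iInf]
    intro μ
    rw [Submodule.mem_orthogonal]
    intro y hy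
    have hsym : ⟪y, T x⟫_ℝ = ⟪T y, x⟫_ℝ := (hs y x).symm
    rw [hsym, hev μ ⟨y, hy⟩, inner_smul_left]
    by_cases hμ : μ = 0
    · simp [hμ]
    · have h0 : ⟪y, x⟫_ℝ = 0 := by
        have hy' := (v ⟨μ, hμ⟩).sum_repr ⟨y, hy⟩
        have hy'' := congrArg (Subtype.val) hy'
        rw [← show _ = y from hy'', Submodule.coe_sum, sum_inner]
        refine Finset.sum_eq_zero fun k _ => ?_
        rw [Submodule.coe_smul, inner_smul_left, hx ⟨⟨μ, hμ⟩, k⟩, mul_zero]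
      rw [h0, mul_zero]
  · intro μ hμ
    have hset : {j : Σ μ : {μ : ℝ // μ ≠ 0},
        Fin (Module.finrank ℝ (eigenspace (T : H →ₗ[ℝ] H) μ)) | (j.1 : ℝ) = μ}
        = Set.range (Sigma.mk (⟨μ, hμ⟩ : {μ : ℝ // μ ≠ 0})) := by
      ext ⟨⟨ν, hν⟩, k⟩
      constructor
      · rintro (rfl : ν = μ)
        exact ⟨k, rfl⟩
      · rintro ⟨k', hk'⟩
        exact (congrArg (fun j => (j.1 : ℝ)) hk').symm
    rw [hset]
    refine ⟨Set.finite_range _, ?_⟩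
    have := hfd ⟨μ, hμ⟩
    rw [← Set.image_univ, sigma_mk_injective.encard_image, ← Module.finrank_eq_rank]
    simp

variable {T : H →L[ℝ] H} {a : ℕ ⊕ₗ ℕᵒᵈ → ℝ}

/-- The eigenvectors of a compact symmetric operator, indexed like its descending spectrum. -/
theorem IsDescendingSpectrum.exists_orthonormal_eigenvectors (hc : IsCompactOperator T)
    (hs : (T : H →ₗ[ℝ] H).IsSymmetric) (ha : IsDescendingSpectrum (T : H →ₗ[ℝ] H) a) :
    ∃ u : {i // a i ≠ 0} → H, Orthonormal ℝ u ∧ (∀ i, T (u i) = a i • u i) ∧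
      ∀ x, (∀ i, ⟪u i, x⟫_ℝ = 0) → T x = 0 := by
  obtain ⟨J, κ, w, hw, hκ, hev, hcompl, hcard⟩ := _root_.exists_orthonormal_eigenvectors hc hs
  -- The two index sets are matched value by value; finiteness of each level makes equal cardinality
  -- yield a bijection.
  have hequiv : ∀ μ : ℝ, μ ≠ 0 → Nonempty ({i // a i = μ} ≃ {j // κ j = μ}) := by
    intro μ hμ
    have h1 : {i | a i = μ}.encard = {j | κ j = μ}.encard := by
      rw [ha.encard_eq μ hμ, (hcard μ hμ).2]
    have f2 := (hcard μ hμ).1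
    have f1 : {i | a i = μ}.Finite := by
      rw [← Set.encard_lt_top_iff, h1]
      exact f2.encard_lt_top
    have : Finite {i // a i = μ} := f1.to_subtype
    have : Finite {j // κ j = μ} := f2.to_subtype
    exact Finite.card_eq.mp (congrArg ENat.toNat h1)
  let e : ∀ μ : ℝ, μ ≠ 0 → ({i // a i = μ} ≃ {j // κ j = μ}) := fun μ hμ => (hequiv μ hμ).some
  let φ : {i // a i ≠ 0} → J := fun i => e (a i) i.2 ⟨i, rfl⟩
  -- This frees `φ` from its dependence on the literal value `a i`, so that indices with equal
  -- values go through the same bijection.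
  have hφ : ∀ i μ (hμ : μ ≠ 0) (h : a i.1 = μ), φ i = e μ hμ ⟨i, h⟩ := by
    rintro i μ hμ rfl
    rfl
  have hκφ : ∀ i, κ (φ i) = a i := fun i => (e (a i) i.2 ⟨i, rfl⟩).2
  have hinj : Function.Injective φ := by
    intro i i' h
    have haa : a i.1 = a i'.1 := by rw [← hκφ, h, hκφ]
    rw [hφ i _ i'.2 haa, hφ i' _ i'.2 rfl] at h
    have := (e _ i'.2).injective (Subtype.ext h)
    exact Subtype.ext (Subtype.mk.inj this)
  refine ⟨w ∘ φ, hw.comp _ hinj, fun i => ?_, fun x hx => hcompl x fun j => ?_⟩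
  · rw [Function.comp_apply, hev, hκφ]
  · have h1 : a ((e (κ j) (hκ j)).symm ⟨j, rfl⟩).1 = κ j := ((e (κ j) (hκ j)).symm ⟨j, rfl⟩).2
    have h2 := hx ⟨((e (κ j) (hκ j)).symm ⟨j, rfl⟩).1, by rw [h1]; exact hκ j⟩
    rw [Function.comp_apply, hφ _ (κ j) (hκ j) h1] at h2
    simpa using h2

/-- Descending spectra exist for operators with square summable values on Hilbert bases. -/
theorem exists_isDescendingSpectrum (hs : (T : H →ₗ[ℝ] H).IsSymmetric)
    (hT : ∀ (s : Set H) (b : HilbertBasis s ℝ H), Summable fun i => ‖T (b i)‖ ^ 2) :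
    ∃ a, IsDescendingSpectrum (T : H →ₗ[ℝ] H) a := by
  obtain ⟨s₀, b₀, -⟩ := exists_hilbertBasis ℝ H
  have hc := isCompactOperator_of_summable_norm_sq b₀ (hT s₀ b₀)
  obtain ⟨J, κ, w, hw, -, hev, hcompl, hcard⟩ := exists_orthonormal_eigenvectors hc hs
  obtain ⟨s, b, hb⟩ := hw.exists_hilbertBasis_hasSum_iff
  have hsum : Summable fun j => κ j ^ 2 := by
    have h1 := (hb (fun x => ‖T x‖ ^ 2) (fun x hx => by simp [hcompl x hx]) _).mp (hT s b).hasSum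
    refine h1.summable.congr fun j => ?_
    simp [hev, norm_smul, hw.norm_eq_one]
  have hfin : ∀ t : ℝ, 0 < t → {j | t < |κ j|}.Finite := by
    intro t ht
    have h1 := hsum.tendsto_cofinite_zero.eventually (gt_mem_nhds (show 0 < t ^ 2 by positivity))
    refine h1.subset fun j hj => ?_
    have hj' : t < |κ j| := hj
    have : t ^ 2 < κ j ^ 2 := by
      rw [← sq_abs (κ j)]
      gcongr
    exact not_lt.mpr this.le
  -- The positive eigenvalues are rearranged directly and the negative ones after a sign change;
  -- square summability leaves finitely many beyond each level.
  obtain ⟨α, hα, hα0, hαc⟩ := exists_antitone_rearrangement κ fun t ht =>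
    (hfin t ht).subset fun j (hj : t < _) => hj.trans_le (le_abs_self _)
  obtain ⟨β, hβ, hβ0, hβc⟩ := exists_antitone_rearrangement (fun j => -κ j) fun t ht =>
    (hfin t ht).subset fun j (hj : t < _) => hj.trans_le (neg_le_abs _)
  refine ⟨fun i => Sum.elim α (fun n => -β (OrderDual.ofDual n)) (ofLex i), ?_, hα0,
    fun i => neg_nonpos.mpr (hβ0 _), ?_⟩
  · intro i j hij
    induction i using Lex.rec with | _ i
    induction j using Lex.rec with | _ j
    rw [Sum.Lex.toLex_le_toLex] at hij
    cases hij with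
    | inl h => exact hα h
    | inr h => exact neg_le_neg (hβ h)
    | sep n m => exact (neg_nonpos.mpr (hβ0 _)).trans (hα0 _)
  · intro μ hμ
    rw [← (hcard μ hμ).2]
    rcases hμ.lt_or_gt with hμ | hμ
    · have h1 : {i : ℕ ⊕ₗ ℕᵒᵈ | Sum.elim α (fun n => -β (OrderDual.ofDual n)) (ofLex i) = μ}
          = (fun n : ℕ => Sum.inrₗ (OrderDual.toDual n)) '' {n | β n = -μ} := by
        ext i
        induction i using Lex.rec with | _ i
        rcases i with n | n
        · constructor
          · rintro (h : α n = μ)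
            have := hα0 n
            linarith
          · rintro ⟨m, -, hm⟩
            cases hm
        · constructor
          · rintro (h : -β (OrderDual.ofDual n) = μ)
            exact ⟨OrderDual.ofDual n, by simp [← h], rfl⟩
          · rintro ⟨m, hm, h⟩
            cases h
            show -β m = μ
            rw [show β m = -μ from hm, neg_neg]
      rw [h1, Function.Injective.encard_image, hβc _ (by linarith)]
      · simp only [neg_inj]
      · intro m n h
        cases h
        rfl
    · have h1 : {i : ℕ ⊕ₗ ℕᵒᵈ | Sum.elim α (fun n => -β (OrderDual.ofDual n)) (ofLex i) = μ}
          = (fun n : ℕ => Sum.inlₗ n) '' {n | α n = μ} := by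
        ext i
        induction i using Lex.rec with | _ i
        rcases i with n | n
        · constructor
          · rintro (h : α n = μ)
            exact ⟨n, h, rfl⟩
          · rintro ⟨m, hm, h⟩
            cases h
            exact hm
        · constructor
          · rintro (h : -β (OrderDual.ofDual n) = μ)
            have := hβ0 (OrderDual.ofDual n)
            linarith
          · rintro ⟨m, -, hm⟩
            cases hm
      rw [h1, Function.Injective.encard_image, hαc _ hμ]
      intro m n h
      cases h
      rfl

/-- A linear endomorphism has at most one descending spectrum. -/
theorem IsDescendingSpectrum.unique {E : Type*} [AddCommGroup E] [Module ℝ E] {T : E →ₗ[ℝ] E}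
    {a b : ℕ ⊕ₗ ℕᵒᵈ → ℝ} (ha : IsDescendingSpectrum T a) (hb : IsDescendingSpectrum T b) :
    a = b := by
  have hpos : ∀ {a : ℕ ⊕ₗ ℕᵒᵈ → ℝ}, IsDescendingSpectrum T a → ∀ μ, 0 < μ →
      {n | a (Sum.inlₗ n) = μ}.encard = {i | a i = μ}.encard := by
    intro a ha μ hμ
    rw [← Function.Injective.encard_image (f := fun n : ℕ => (Sum.inlₗ n : ℕ ⊕ₗ ℕᵒᵈ))
      fun m n h => by cases h; rfl]
    congr 1
    ext i
    constructor
    · rintro ⟨n, hn, rfl⟩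
      exact hn
    · intro h
      induction i using Lex.rec with | _ i
      rcases i with n | n
      · exact ⟨n, h, rfl⟩
      · have h1 : a (Sum.inrₗ n) = μ := h
        have := ha.nonpos n
        linarith
  have hneg : ∀ {a : ℕ ⊕ₗ ℕᵒᵈ → ℝ}, IsDescendingSpectrum T a → ∀ μ, 0 < μ →
      {n : ℕ | -a (Sum.inrₗ (OrderDual.toDual n)) = μ}.encard = {i | a i = -μ}.encard := by
    intro a ha μ hμ
    rw [← Function.Injective.encard_image
      (f := fun n : ℕ => (Sum.inrₗ (OrderDual.toDual n) : ℕ ⊕ₗ ℕᵒᵈ)) fun m n h => by cases h; rfl]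
    congr 1
    ext i
    constructor
    · rintro ⟨n, hn, rfl⟩
      exact neg_eq_iff_eq_neg.mp hn
    · intro h
      induction i using Lex.rec with | _ i
      rcases i with n | n
      · have h1 : a (Sum.inlₗ n) = -μ := h
        have := ha.nonneg n
        linarith
      · exact ⟨OrderDual.ofDual n, neg_eq_iff_eq_neg.mpr h, rfl⟩
  have h1 := eq_of_antitone_of_encard_eq (α := fun n => a (Sum.inlₗ n))
    (β := fun n => b (Sum.inlₗ n))
    (ha.antitone.comp_monotone fun m n h => Sum.Lex.inl_le_inl_iff.mpr h)
    (hb.antitone.comp_monotone fun m n h => Sum.Lex.inl_le_inl_iff.mpr h) ha.nonneg hb.nonneg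
    fun μ hμ => by
      rw [hpos ha μ hμ, hpos hb μ hμ, ha.encard_eq μ hμ.ne', hb.encard_eq μ hμ.ne']
  have h2 := eq_of_antitone_of_encard_eq (α := fun n => -a (Sum.inrₗ (OrderDual.toDual n)))
    (β := fun n => -b (Sum.inrₗ (OrderDual.toDual n)))
    (fun m n h => neg_le_neg (ha.antitone (Sum.Lex.inr_le_inr_iff.mpr h)))
    (fun m n h => neg_le_neg (hb.antitone (Sum.Lex.inr_le_inr_iff.mpr h)))
    (fun n => neg_nonneg.mpr (ha.nonpos _)) (fun n => neg_nonneg.mpr (hb.nonpos _))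
    fun μ hμ => by
      rw [hneg ha μ hμ, hneg hb μ hμ, ha.encard_eq _ (neg_ne_zero.mpr hμ.ne'),
        hb.encard_eq _ (neg_ne_zero.mpr hμ.ne')]
  funext i
  induction i using Lex.rec with | _ i
  rcases i with n | n
  · exact congrFun h1 n
  · exact neg_injective (congrFun h2 (OrderDual.ofDual n))

end Spectrum

/-! ### Hilbert–Schmidt operators and the Hoffman–Wielandt inequality -/

section HilbertSchmidt

variable {H : Type*} [NormedAddCommGroup H] [InnerProductSpace ℝ H] [CompleteSpace H]

/-- `T` is a Hilbert–Schmidt operator with squared Hilbert–Schmidt norm `c`. -/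
def HasHilbertSchmidtNormSq (T : H →L[ℝ] H) (c : ℝ) : Prop :=
  ∀ (s : Set H) (b : HilbertBasis s ℝ H), HasSum (fun i => ‖T (b i)‖ ^ 2) c

theorem HasHilbertSchmidtNormSq.isCompactOperator {T : H →L[ℝ] H} {c : ℝ}
    (hT : HasHilbertSchmidtNormSq T c) : IsCompactOperator T := by
  obtain ⟨s, b, -⟩ := exists_hilbertBasis ℝ H
  exact isCompactOperator_of_summable_norm_sq b (hT s b).summable

/-- The eigenvectors of a compact symmetric operator, indexed like its descending spectrum and
padded with zeros. -/
theorem IsDescendingSpectrum.exists_eigenvectors {T : H →L[ℝ] H} {a : ℕ ⊕ₗ ℕᵒᵈ → ℝ}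
    (hc : IsCompactOperator T) (hs : (T : H →ₗ[ℝ] H).IsSymmetric)
    (ha : IsDescendingSpectrum (T : H →ₗ[ℝ] H) a) :
    ∃ u : ℕ ⊕ₗ ℕᵒᵈ → H, (∀ i, T (u i) = a i • u i) ∧ (∀ i, ‖u i‖ ≤ 1) ∧
      (∀ i, a i ≠ 0 → ‖u i‖ = 1) ∧
      (∀ x (F : Finset (ℕ ⊕ₗ ℕᵒᵈ)), ∑ i ∈ F, ⟪u i, x⟫_ℝ ^ 2 ≤ ‖x‖ ^ 2) ∧
      ∃ (s : Set H) (b : HilbertBasis s ℝ H), ∀ G : H → ℝ, (∀ x, T x = 0 → G x = 0) →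
        ∀ τ, HasSum (fun i => G (b i)) τ → HasSum (fun i => G (u i)) τ := by
  classical
  obtain ⟨u, hu, hev, hcompl⟩ := ha.exists_orthonormal_eigenvectors hc hs
  obtain ⟨s, b, hb⟩ := hu.exists_hilbertBasis_hasSum_iff
  set U : ℕ ⊕ₗ ℕᵒᵈ → H := fun i => if h : a i ≠ 0 then u ⟨i, h⟩ else 0 with hU
  have hU0 : ∀ i, ¬ a i ≠ 0 → U i = 0 := fun i hi => by simp only [hU, dif_neg hi]
  have hU1 : ∀ i : {i // a i ≠ 0}, U i = u i := fun i => by simp only [hU, dif_pos i.2]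
  have hnorm : ∀ i, a i ≠ 0 → ‖U i‖ = 1 := fun i hi => by
    rw [hU1 ⟨i, hi⟩, hu.norm_eq_one]
  refine ⟨U, fun i => ?_, fun i => ?_, hnorm, fun x F => ?_, s, b, fun G hG τ h => ?_⟩
  · by_cases hi : a i ≠ 0
    · rw [hU1 ⟨i, hi⟩, hev]
    · simp [hU0 i hi]
  · by_cases hi : a i ≠ 0
    · exact (hnorm i hi).le
    · simp [hU0 i hi]
  · have h1 : ∑ i ∈ F.subtype (fun i => a i ≠ 0), ⟪U i, x⟫_ℝ ^ 2 = ∑ i ∈ F, ⟪U i, x⟫_ℝ ^ 2 := by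
      rw [Finset.sum_subtype_eq_sum_filter (f := fun i => ⟪U i, x⟫_ℝ ^ 2),
        Finset.sum_filter_of_ne]
      intro i _ hne
      by_contra hi
      exact hne (by rw [hU0 i (not_not.mpr hi), inner_zero_left, sq, mul_zero])
    rw [← h1]
    have h2 := hu.sum_inner_products_le (s := F.subtype (fun i => a i ≠ 0)) x
    simpa only [hU1, Real.norm_eq_abs, sq_abs] using h2
  · have h1 := (hb G (fun x hx => hG x (hcompl x hx)) τ).mp h
    have h2 : HasSum ((fun i => G (U i)) ∘ ((↑) : {i | a i ≠ 0} → ℕ ⊕ₗ ℕᵒᵈ)) τ := by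
      refine h1.congr_fun ?_
      exact fun i => by rw [Function.comp_apply, ← hU1]
    refine (hasSum_subtype_iff_of_support_subset fun i hi => ?_).mp h2
    by_contra hni
    exact hi (show G (U i) = 0 by rw [hU0 i hni]; exact hG 0 (map_zero T))

/-- The descending spectrum of a symmetric Hilbert–Schmidt operator is square summable. -/
theorem IsDescendingSpectrum.hasSum_sq {T : H →L[ℝ] H} {a : ℕ ⊕ₗ ℕᵒᵈ → ℝ} {c : ℝ}
    (hT : HasHilbertSchmidtNormSq T c) (hs : (T : H →ₗ[ℝ] H).IsSymmetric)
    (ha : IsDescendingSpectrum (T : H →ₗ[ℝ] H) a) : HasSum (fun i => a i ^ 2) c := by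
  obtain ⟨u, hev, -, hnorm, -, s, b, hb⟩ := ha.exists_eigenvectors hT.isCompactOperator hs
  have h := hb (fun x => ‖T x‖ ^ 2) (fun x hx => by simp [hx]) c (hT s b)
  refine h.congr_fun fun i => ?_
  by_cases hi : a i = 0
  · simp [hev, hi]
  · simp [hev, norm_smul, hnorm i hi]

/-- A summable function on `ℕ ⊕ₗ ℕᵒᵈ` is summable over both copies of `ℕ`. -/
theorem hasSum_inlₗ_inrₗ {f : ℕ ⊕ₗ ℕᵒᵈ → ℝ} (hf : Summable f) :
    Summable (fun n : ℕ => f (Sum.inlₗ n)) ∧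
      Summable (fun n : ℕ => f (Sum.inrₗ (OrderDual.toDual n))) ∧
      ∑' i, f i = ∑' n : ℕ, f (Sum.inlₗ n) + ∑' n : ℕ, f (Sum.inrₗ (OrderDual.toDual n)) := by
  have h1 : Summable (fun n : ℕ => f (Sum.inlₗ n)) :=
    hf.comp_injective (i := fun n : ℕ => (Sum.inlₗ n : ℕ ⊕ₗ ℕᵒᵈ)) fun m n h => by cases h; rfl
  have h2 : Summable (fun n : ℕ => f (Sum.inrₗ (OrderDual.toDual n))) :=
    hf.comp_injective (i := fun n : ℕ => (Sum.inrₗ (OrderDual.toDual n) : ℕ ⊕ₗ ℕᵒᵈ))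
      fun m n h => by cases h; rfl
  refine ⟨h1, h2, ?_⟩
  let e : ℕ ⊕ ℕ ≃ ℕ ⊕ₗ ℕᵒᵈ := ((Equiv.refl ℕ).sumCongr OrderDual.toDual).trans toLex
  rw [← e.tsum_eq f]
  exact Summable.tsum_sum h1 h2

/-- The infinite-dimensional Hoffman–Wielandt inequality for symmetric Hilbert–Schmidt operators
with descending spectra. -/
theorem IsDescendingSpectrum.tsum_sub_sq_le {A B : H →L[ℝ] H} {a b : ℕ ⊕ₗ ℕᵒᵈ → ℝ} {cA cB c : ℝ}
    (hA : HasHilbertSchmidtNormSq A cA) (hB : HasHilbertSchmidtNormSq B cB)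
    (hAB : HasHilbertSchmidtNormSq (A - B) c)
    (hAs : (A : H →ₗ[ℝ] H).IsSymmetric) (hBs : (B : H →ₗ[ℝ] H).IsSymmetric)
    (ha : IsDescendingSpectrum (A : H →ₗ[ℝ] H) a) (hb : IsDescendingSpectrum (B : H →ₗ[ℝ] H) b) :
    ∑' i, (a i - b i) ^ 2 ≤ c := by
  have hsa := ha.hasSum_sq hA hAs
  have hsb := hb.hasSum_sq hB hBs
  obtain ⟨u, huev, hu1, -, hubes, s, e, he⟩ := ha.exists_eigenvectors hA.isCompactOperator hAs
  obtain ⟨v, hvev, hv1, -, hvbes, s', e', he'⟩ := hb.exists_eigenvectors hB.isCompactOperator hBs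
  have hsab : Summable fun i => a i * b i := by
    refine Summable.of_norm_bounded (hsa.summable.add hsb.summable) fun i => ?_
    rw [Real.norm_eq_abs, abs_le]
    constructor <;> nlinarith [sq_nonneg (a i + b i), sq_nonneg (a i - b i)]
  -- This is `tr(AB)`: polarisation gives its value in the basis `e`, and since the summand vanishes
  -- on the kernel of `A`, the eigenvectors `u` carry the whole sum.
  have htr : HasSum (fun i => a i * ⟪u i, B (u i)⟫_ℝ) ((cA + cB - c) / 2) := by
    have h1 : HasSum (fun i => ⟪A (e i), B (e i)⟫_ℝ) ((cA + cB - c) / 2) := by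
      refine ((((hA s e).add (hB s e)).sub (hAB s e)).div_const 2).congr_fun fun i => ?_
      rw [sub_apply, norm_sub_sq_real]
      ring
    have h2 := he (fun x => ⟪A x, B x⟫_ℝ) (fun x hx => by simp [hx]) _ h1
    refine h2.congr_fun fun i => ?_
    simp only [huev, inner_smul_left, conj_trivial]
  -- Parseval in a basis extending the eigenvectors of `B` diagonalises its quadratic form.
  have hquad : ∀ x, HasSum (fun j => b j * ⟪v j, x⟫_ℝ ^ 2) ⟪x, B x⟫_ℝ := by
    intro x
    have h1 := e'.hasSum_inner_mul_inner x (B x)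
    have h2 : HasSum (fun j => ⟪x, e' j⟫_ℝ * ⟪B (e' j), x⟫_ℝ) ⟪x, B x⟫_ℝ := by
      refine h1.congr_fun fun j => ?_
      exact congrArg _ (hBs (e' j) x)
    have h3 := he' (fun y => ⟪x, y⟫_ℝ * ⟪B y, x⟫_ℝ) (fun y hy => by simp [hy]) _ h2
    refine h3.congr_fun fun j => ?_
    simp only [hvev, inner_smul_left, conj_trivial, real_inner_comm (v j) x]
    ring
  have hDrow : ∀ i (g : ℕ → ℕ ⊕ₗ ℕᵒᵈ), Function.Injective g → ∀ N,
      ∑ j ∈ Finset.range N, ⟪v (g j), u i⟫_ℝ ^ 2 ≤ 1 := by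
    intro i g hg N
    have := hvbes (u i) ((Finset.range N).map ⟨g, hg⟩)
    rw [Finset.sum_map] at this
    exact this.trans (pow_le_one₀ (norm_nonneg _) (hu1 i))
  have hDcol : ∀ j (g : ℕ → ℕ ⊕ₗ ℕᵒᵈ), Function.Injective g → ∀ N,
      ∑ i ∈ Finset.range N, ⟪v j, u (g i)⟫_ℝ ^ 2 ≤ 1 := by
    intro j g hg N
    have := hubes (v j) ((Finset.range N).map ⟨g, hg⟩)
    rw [Finset.sum_map] at this
    simp only [real_inner_comm (v j)] at this ⊢
    exact this.trans (pow_le_one₀ (norm_nonneg _) (hv1 j))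
  have hl : Function.Injective fun n : ℕ => (Sum.inlₗ n : ℕ ⊕ₗ ℕᵒᵈ) := fun m n h => by cases h; rfl
  have hr : Function.Injective fun n : ℕ => (Sum.inrₗ (OrderDual.toDual n) : ℕ ⊕ₗ ℕᵒᵈ) :=
    fun m n h => by cases h; rfl
  obtain ⟨t1, t2, t3⟩ := hasSum_inlₗ_inrₗ htr.summable
  obtain ⟨p1, p2, p3⟩ := hasSum_inlₗ_inrₗ hsab
  -- On eigenvectors of `A` with positive eigenvalue, the negative part of `B` only lowers the
  -- quadratic form, so omitting it gives the required upper bound.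
  have hpos := tsum_mul_le_tsum_mul (α := fun n => a (Sum.inlₗ n)) (β := fun n => b (Sum.inlₗ n))
    (γ := fun n => ⟪u (Sum.inlₗ n), B (u (Sum.inlₗ n))⟫_ℝ)
    (D := fun i j => ⟪v (Sum.inlₗ j), u (Sum.inlₗ i)⟫_ℝ ^ 2) (fun i j => sq_nonneg _)
    (fun N i => hDrow _ _ hl N) (fun N j => hDcol _ _ hl N)
    (ha.antitone.comp_monotone fun m n h => Sum.Lex.inl_le_inl_iff.mpr h)
    (hb.antitone.comp_monotone fun m n h => Sum.Lex.inl_le_inl_iff.mpr h) ha.nonneg hb.nonneg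
    (fun i _ => by
      obtain ⟨q1, q2, q3⟩ := hasSum_inlₗ_inrₗ (hquad (u (Sum.inlₗ i))).summable
      refine ⟨_, ?_, q1.hasSum⟩
      rw [← (hquad (u (Sum.inlₗ i))).tsum_eq, q3]
      have := tsum_nonpos (L := .unconditional ℕ) fun n : ℕ => mul_nonpos_of_nonpos_of_nonneg
        (hb.nonpos (OrderDual.toDual n))
        (sq_nonneg ⟪v (Sum.inrₗ (OrderDual.toDual n)), u (Sum.inlₗ i)⟫_ℝ)
      linarith) t1 p1
  -- The same argument for `-A` and `-B`, whose products of eigenvalues are unchanged.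
  have hneg := tsum_mul_le_tsum_mul (α := fun n => -a (Sum.inrₗ (OrderDual.toDual n)))
    (β := fun n => -b (Sum.inrₗ (OrderDual.toDual n)))
    (γ := fun n => -⟪u (Sum.inrₗ (OrderDual.toDual n)), B (u (Sum.inrₗ (OrderDual.toDual n)))⟫_ℝ)
    (D := fun i j =>
      ⟪v (Sum.inrₗ (OrderDual.toDual j)), u (Sum.inrₗ (OrderDual.toDual i))⟫_ℝ ^ 2)
    (fun i j => sq_nonneg _) (fun N i => hDrow _ _ hr N) (fun N j => hDcol _ _ hr N)
    (fun m n h => neg_le_neg (ha.antitone (Sum.Lex.inr_le_inr_iff.mpr h)))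
    (fun m n h => neg_le_neg (hb.antitone (Sum.Lex.inr_le_inr_iff.mpr h)))
    (fun n => neg_nonneg.mpr (ha.nonpos _)) (fun n => neg_nonneg.mpr (hb.nonpos _))
    (fun i _ => by
      obtain ⟨q1, q2, q3⟩ :=
        hasSum_inlₗ_inrₗ (hquad (u (Sum.inrₗ (OrderDual.toDual i)))).summable
      refine ⟨_, ?_, q2.hasSum.neg.congr_fun fun j => neg_mul _ _⟩
      rw [← (hquad (u (Sum.inrₗ (OrderDual.toDual i)))).tsum_eq, q3]
      have := tsum_nonneg (L := .unconditional ℕ) fun n : ℕ => mul_nonneg (hb.nonneg n)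
        (sq_nonneg ⟪v (Sum.inlₗ n), u (Sum.inrₗ (OrderDual.toDual i))⟫_ℝ)
      linarith) (by simpa only [neg_mul_neg] using t2) (by simpa only [neg_mul_neg] using p2)
  simp only [neg_mul_neg] at hneg
  have hle : (cA + cB - c) / 2 ≤ ∑' i, a i * b i := by
    rw [← htr.tsum_eq, t3, p3]
    exact add_le_add hpos hneg
  have hfin : HasSum (fun i => (a i - b i) ^ 2) (cA + cB - 2 * ∑' i, a i * b i) :=
    ((hsa.add hsb).sub (hsab.hasSum.mul_left 2)).congr_fun fun i => by ring
  rw [hfin.tsum_eq]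
  linarith

end HilbertSchmidt

/-! ### Hilbert–Schmidt norms of integral operators -/

/-- An orthonormal family in a separable inner product space is countable. -/
theorem Orthonormal.countable {H ι : Type*} [NormedAddCommGroup H] [InnerProductSpace ℝ H]
    [TopologicalSpace.SeparableSpace H] {v : ι → H} (hv : Orthonormal ℝ v) : Countable ι := by
  -- Distinct members lie at distance `√2 > 1`, so balls of radius 1/2 are disjoint.
  refine Pairwise.countable_of_isOpen_disjoint (s := fun i => Metric.ball (v i) (1 / 2)) ?_
    (fun i => Metric.isOpen_ball) fun i => ⟨v i, Metric.mem_ball_self (by norm_num)⟩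
  intro i j hij
  refine Metric.ball_disjoint_ball ?_
  have h : ‖v i - v j‖ ^ 2 = 2 := by
    rw [norm_sub_sq_real, hv.2 hij, hv.norm_eq_one, hv.norm_eq_one]
    norm_num
  rw [dist_eq_norm]
  nlinarith [norm_nonneg (v i - v j)]

theorem L2Unit.norm_sq_eq_integral (g : L2Unit) : ‖g‖ ^ 2 = ∫ x, g x ^ 2 := by
  rw [← real_inner_self_eq_norm_sq, L2.inner_def]
  simp only [real_inner_self_eq_norm_sq, Real.norm_eq_abs, sq_abs]

/-- The sum of the squared norms of the values on a Hilbert basis of the integral operator of a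
bounded kernel is the squared `L²` norm of the kernel. -/
theorem hasSum_norm_sq_of_integral_kernel {k : unitInterval → unitInterval → ℝ}
    (hk : AEMeasurable (Function.uncurry k) volume) (hb : ∀ x y, |k x y| ≤ 1)
    {T : L2Unit → L2Unit} (hT : ∀ g : L2Unit, T g =ᵐ[volume] fun x => ∫ y, k x y * g y)
    {ι : Type*} (b : HilbertBasis ι ℝ L2Unit) :
    HasSum (fun i => ‖T (b i)‖ ^ 2)
      (∫ z : unitInterval × unitInterval, k z.1 z.2 ^ 2) := by
  have : Fact ((2 : ENNReal) ≠ ⊤) := ⟨by norm_num⟩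
  have := b.orthonormal.countable
  have hks : AEStronglyMeasurable (Function.uncurry k)
      ((volume : Measure unitInterval).prod volume) := hk.aestronglyMeasurable
  have hk2 : Integrable (fun z : unitInterval × unitInterval => k z.1 z.2 ^ 2)
      ((volume : Measure unitInterval).prod volume) := by
    refine Integrable.of_bound (hks.pow 2) 1 (Filter.Eventually.of_forall fun z => ?_)
    rw [Real.norm_eq_abs, abs_pow]
    exact pow_le_one₀ (abs_nonneg _) (hb _ _)
  -- For almost every `x`, the numbers `T (b i) x` are the coefficients of the slice `k x` in the
  -- basis `b`. Countability of the basis lets one null set serve all `i`.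
  have hpt : ∀ᵐ x, HasSum (fun i => T (b i) x ^ 2) (∫ y, k x y ^ 2) := by
    filter_upwards [hks.prodMk_left, ae_all_iff.mpr fun i => hT (b i)] with x hx hTx
    have hmem : MemLp (k x) 2 volume :=
      MemLp.of_bound hx 1 (Filter.Eventually.of_forall (hb x))
    have hco := hmem.coeFn_toLp
    have h1 := b.hasSum_inner_mul_inner (hmem.toLp (k x)) (hmem.toLp (k x))
    have h2 : ⟪hmem.toLp (k x), hmem.toLp (k x)⟫_ℝ = ∫ y, k x y ^ 2 := by
      rw [real_inner_self_eq_norm_sq, L2Unit.norm_sq_eq_integral]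
      refine integral_congr_ae ?_
      filter_upwards [hco] with y hy
      rw [hy]
    rw [h2] at h1
    refine h1.congr_fun fun i => ?_
    have h3 : ⟪b i, hmem.toLp (k x)⟫_ℝ = T (b i) x := by
      rw [hTx i, L2.inner_def]
      refine integral_congr_ae ?_
      filter_upwards [hco] with y hy
      rw [hy]
      simp
    rw [real_inner_comm, h3, sq]
  have hint : Integrable (fun x => ∫ y, k x y ^ 2) volume := hk2.integral_prod_left
  -- The terms are nonnegative and serve as their own dominating functions.
  have hsum := hasSum_integral_of_dominated_convergence (μ := (volume : Measure unitInterval))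
    (F := fun i x => T (b i) x ^ 2) (f := fun x => ∫ y, k x y ^ 2) (fun i x => T (b i) x ^ 2)
    (fun i => (Lp.aestronglyMeasurable _).pow 2)
    (fun i => Filter.Eventually.of_forall fun x => by simp)
    (hpt.mono fun x hx => hx.summable)
    (hint.congr (hpt.mono fun x hx => hx.tsum_eq.symm)) hpt
  simp only [← L2Unit.norm_sq_eq_integral] at hsum
  rw [← integral_prod _ hk2] at hsum
  exact hsum

/-! ### Operators of graph kernels -/

namespace GraphKernel

theorem coeFn_integralOperator (f : GraphKernel) (g : L2Unit) :
    f.integralOperator g =ᵐ[volume] fun x => ∫ y, f x y * g y :=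
  (f.memLp_integralFun g).coeFn_toLp

theorem abs_le_one (f : GraphKernel) (x y : unitInterval) : |f x y| ≤ 1 := by
  obtain ⟨h0, h1⟩ := f.mem_Icc' x y
  rwa [abs_of_nonneg h0]

/-- Fubini and the symmetry of the kernel; the integrand is dominated by the integrable product of
`|g y|` and `|h x|`. -/
theorem isSymmetric_integralOperator (f : GraphKernel) : f.integralOperator.IsSymmetric := by
  intro g h
  have hf : AEStronglyMeasurable (Function.uncurry f.toFun)
      ((volume : Measure unitInterval).prod volume) := f.aemeasurable'.aestronglyMeasurable
  have hint : Integrable (Function.uncurry fun x y => f x y * g y * h x)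
      ((volume : Measure unitInterval).prod volume) := by
    have h1 := (integrable_L2 h).mul_prod (integrable_L2 g)
    refine h1.mono ((hf.mul (Lp.aestronglyMeasurable g).comp_snd).mul
      (Lp.aestronglyMeasurable h).comp_fst) (Filter.Eventually.of_forall fun z => ?_)
    simp only [Function.uncurry, norm_mul]
    rw [mul_comm]
    refine mul_le_mul_of_nonneg_left ?_ (norm_nonneg _)
    rw [← norm_mul]
    exact f.norm_mul_le g z.1 z.2
  have hl : ⟪f.integralOperator g, h⟫_ℝ = ∫ x, ∫ y, f x y * g y * h x := by
    rw [L2.inner_def]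
    refine integral_congr_ae ?_
    filter_upwards [f.coeFn_integralOperator g] with x hx
    rw [hx, integral_mul_const]
    simp [mul_comm]
  have hr : ⟪g, f.integralOperator h⟫_ℝ = ∫ y, ∫ x, f x y * g y * h x := by
    rw [L2.inner_def]
    refine integral_congr_ae ?_
    filter_upwards [f.coeFn_integralOperator h] with y hy
    rw [hy]
    simp only [f.symm' _ y, mul_right_comm _ (g y)]
    rw [integral_mul_const]
    simp [mul_comm]
  rw [hl, hr]
  exact integral_integral_swap hint

/-- The integral operator of a kernel as a bounded operator. -/
noncomputable def integralCLM (f : GraphKernel) : L2Unit →L[ℝ] L2Unit :=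
  -- Continuity is the Hellinger–Toeplitz theorem.
  ⟨f.integralOperator, f.isSymmetric_integralOperator.continuous⟩

theorem hasHilbertSchmidtNormSq (f : GraphKernel) : HasHilbertSchmidtNormSq f.integralCLM
    (∫ z : unitInterval × unitInterval, f z.1 z.2 ^ 2) := fun _ b =>
  hasSum_norm_sq_of_integral_kernel f.aemeasurable' f.abs_le_one f.coeFn_integralOperator b

theorem abs_sub_le_one (f g : GraphKernel) (x y : unitInterval) : |f x y - g x y| ≤ 1 := by
  obtain ⟨h0, h1⟩ := f.mem_Icc' x y
  obtain ⟨h2, h3⟩ := g.mem_Icc' x y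
  rw [abs_le]
  constructor <;> linarith

/-- A difference of kernels may be negative and so is no `GraphKernel`, but it is still bounded by 1
in absolute value, which is all that the general kernel lemma requires. -/
theorem hasHilbertSchmidtNormSq_sub (f g : GraphKernel) :
    HasHilbertSchmidtNormSq (f.integralCLM - g.integralCLM)
      (∫ z : unitInterval × unitInterval, (f z.1 z.2 - g z.1 z.2) ^ 2) := fun _ b => by
  refine hasSum_norm_sq_of_integral_kernel (k := fun x y => f x y - g x y)
    (T := fun h => (f.integralCLM - g.integralCLM) h)
    (f.aemeasurable'.sub g.aemeasurable') (f.abs_sub_le_one g) (fun h => ?_) b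
  filter_upwards [Lp.coeFn_sub (f.integralOperator h) (g.integralOperator h),
    f.coeFn_integralOperator h, g.coeFn_integralOperator h, f.ae_integrable_mul h,
    g.ae_integrable_mul h] with x h1 h2 h3 h4 h5
  simp only [sub_mul]
  rw [integral_sub h4 h5, ← h2, ← h3]
  exact h1

theorem existsUnique_isDescendingSpectrum (f : GraphKernel) :
    ∃! a, IsDescendingSpectrum f.integralOperator a := by
  obtain ⟨a, ha⟩ := exists_isDescendingSpectrum (T := f.integralCLM)
    f.isSymmetric_integralOperator fun s b => (f.hasHilbertSchmidtNormSq s b).summable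
  exact ⟨a, ha, fun b hb => IsDescendingSpectrum.unique hb ha⟩

theorem integral_sub_sq_lt (f g : GraphKernel) {ε : ℝ} (hε : 0 < ε)
    (h : eLpNorm (fun z : unitInterval × unitInterval => f z.1 z.2 - g z.1 z.2) 2 volume
      < ENNReal.ofReal ε) :
    ∫ z : unitInterval × unitInterval, (f z.1 z.2 - g z.1 z.2) ^ 2 < ε ^ 2 := by
  have hmem : MemLp (fun z : unitInterval × unitInterval => f z.1 z.2 - g z.1 z.2) 2 volume :=
    MemLp.of_bound (f.aemeasurable'.sub g.aemeasurable').aestronglyMeasurable 1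
      (Filter.Eventually.of_forall fun z => f.abs_sub_le_one g z.1 z.2)
  rw [hmem.eLpNorm_eq_integral_rpow_norm (by norm_num) (by norm_num),
    ENNReal.ofReal_lt_ofReal_iff hε] at h
  simp only [ENNReal.toReal_ofNat, Real.rpow_ofNat, Real.norm_eq_abs, sq_abs] at h
  rw [← one_div, ← Real.sqrt_eq_rpow, Real.sqrt_lt' hε] at h
  exact h

end GraphKernel

theorem mainTheorem3 (f fSBM : GraphKernel) (hSBM : fSBM ∈ sbmKernels) :
    -- the sorted spectra exist and are unique
    (∃! a, IsDescendingSpectrum f.integralOperator a) ∧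
    (∃! b, IsDescendingSpectrum fSBM.integralOperator b) ∧
    ∀ a b : ℕ ⊕ₗ ℕᵒᵈ → ℝ, IsDescendingSpectrum f.integralOperator a →
      IsDescendingSpectrum fSBM.integralOperator b →
      -- they lie in ℓ², with norms equal to the Hilbert-Schmidt norms of the operators
      HasSum (fun i => a i ^ 2) (∫ z : unitInterval × unitInterval, f z.1 z.2 ^ 2) ∧
      HasSum (fun i => b i ^ 2) (∫ z : unitInterval × unitInterval, fSBM z.1 z.2 ^ 2) ∧
      -- and they are close when the kernels are close
      ∀ ε : ℝ, 0 < ε →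
        eLpNorm (fun z : unitInterval × unitInterval => f z.1 z.2 - fSBM z.1 z.2) 2 volume
          < ENNReal.ofReal ε →
        Real.sqrt (∑' i, (a i - b i) ^ 2) < 25 / 4 * ε := by
  refine ⟨f.existsUnique_isDescendingSpectrum, fSBM.existsUnique_isDescendingSpectrum,
    fun a b ha hb => ⟨?_, ?_, fun ε hε h => ?_⟩⟩
  · exact ha.hasSum_sq (T := f.integralCLM) f.hasHilbertSchmidtNormSq
      f.isSymmetric_integralOperator
  · exact hb.hasSum_sq (T := fSBM.integralCLM) fSBM.hasHilbertSchmidtNormSq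
      fSBM.isSymmetric_integralOperator
  · have h1 := IsDescendingSpectrum.tsum_sub_sq_le (A := f.integralCLM) (B := fSBM.integralCLM)
      f.hasHilbertSchmidtNormSq fSBM.hasHilbertSchmidtNormSq (f.hasHilbertSchmidtNormSq_sub fSBM)
      f.isSymmetric_integralOperator fSBM.isSymmetric_integralOperator ha hb
    have h2 := h1.trans_lt (f.integral_sub_sq_lt fSBM hε h)
    calc Real.sqrt (∑' i, (a i - b i) ^ 2) < ε := (Real.sqrt_lt' hε).mpr h2
      _ ≤ 25 / 4 * ε := by linarith
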